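/- Permutations are written in one-line notation, as words. Let $\mathbf{S}$ be the stack sorting operator, $\mathbf{S}(\varepsilon)=\varepsilon$ and $\mathbf{S}(\alpha n\beta)=\mathbf{S}(\alpha)\,\mathbf{S}(\beta)\,n$, where $n$ is the maximum of the word $\alpha n\beta$ of distinct values, and let $\mathbf{R}$ be reversal of words. For a word of distinct values let $\mathrm{T_{in}}(\varepsilon)$ be the empty tree and let $\mathrm{T_{in}}(\alpha n\beta)$ be the binary tree with root $n$, left subtree $\mathrm{T_{in}}(\alpha)$ and right subtree $\mathrm{T_{in}}(\beta)$; this is the decreasing binary tree whose in-order reading is the given word. Write $\alpha\oplus\beta=\alpha\,(\beta+|\alpha|)$ and $\alpha\ominus\beta=(\alpha+|\beta|)\,\beta$. A permutation is in $\mathrm{Av}(231)$ if it has no subword $b\,c\,a$ (not necessarily consecutive) with $a<b<c$. Every nonempty $\pi\in\mathrm{Av}(231)$ is uniquely $\alpha\oplus(1\ominus\beta)$ with $\alpha,\beta\in\mathrm{Av}(231)$ possibly empty, and the map $P$ on $\mathrm{Av}(231)$ is defined by $P(\varepsilon)=\varepsilon$ and $P(\alpha\oplus(1\ominus\beta))=(P(\alpha)\oplus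 1)\ominus P(\beta)$. For $\pi\in\mathrm{Av}(231)$ of size $n$ let $\lambda_\pi$ be the permutation of $\{1,\dots,n\}$ with $P(\pi)=\lambda_\pi\circ\pi$; applying $\lambda_\pi$ to a tree with labels in $\{1,\dots,n\}$ means applying it to each label. Theorem. Let $\mathbf{A}$ be any operator on permutations formed by composition from $\{\mathbf{S},\mathbf{R}\}$ (the identity, as the empty composition, is allowed). For a permutation $\pi$ let $\mathbf{A}^{-1}(\pi)$ be the set of permutations $\theta$ with $\mathbf{A}(\theta)=\pi$, and for $\theta$ with $\mathbf{A}(\theta)\in\mathrm{Av}(231)$ put $\Phi_{\mathbf{A}}(\theta)=\lambda_{\mathbf{A}(\theta)}\circ\theta$. Then $\mathbf{A}$ respects $P$, that is, for every $\pi\in\mathrm{Av}(231)$ in the image of $\mathbf{A}$: 1. for every $\theta\in\mathbf{A}^{-1}(\pi)$ (so that $\Phi_{\mathbf{A}}(\theta)=\lambda_\pi\circ\theta$) we have $\mathbf{A}(\Phi_{\mathbf{A}}(\theta))=P(\pi)=\lambda_\pi\circ\pi$ and $\mathrm{T_{in}}(\Phi_{\mathbf{A}}(\theta))=\lambda_\pi(\mathrm{T_{in}}(\theta))$;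 2. $\theta\mapsto\Phi_{\mathbf{A}}(\theta)$ is a bijection from $\mathbf{A}^{-1}(\pi)$ onto $\mathbf{A}^{-1}(P(\pi))$. -/

import Mathlib

namespace StackSort

/-! Permutations are written in one-line notation, as words (lists) of natural numbers. -/

/-- `π` is a permutation of `[n] = {1, …, n}`, where `n` is its length. -/
def IsPermutation (π : List ℕ) : Prop :=
  π.Perm (List.range' 1 π.length)

/-- `π` avoids the pattern `231`: it has no (not necessarily consecutive) subword `b c a`
with `a < b < c`. -/
def Avoids231 (π : List ℕ) : Prop :=
  ∀ a b c : ℕ, a < b → b < c → ¬ List.Sublist [b, c, a] π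

/-! A nonempty word of distinct values is written `α n β`, where `n` is its maximum. -/

/-- The maximum of a word (`0` for the empty word). -/
def maxVal (l : List ℕ) : ℕ := l.foldr max 0

/-- The part `α` of `α n β`. -/
def beforeMax (l : List ℕ) : List ℕ := l.take (l.idxOf (maxVal l))

/-- The part `β` of `α n β`. -/
def afterMax (l : List ℕ) : List ℕ := l.drop (l.idxOf (maxVal l) + 1)

theorem maxVal_mem {l : List ℕ} (h : l ≠ []) : maxVal l ∈ l := by
  induction l with
  | nil => exact absurd rfl h
  | cons x xs ih =>
    by_cases hx : xs = []
    · subst hx; simp [maxVal]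
    · have h1 := ih hx
      have h2 : maxVal (x :: xs) = max x (maxVal xs) := rfl
      rw [h2]
      rcases le_total x (maxVal xs) with h3 | h3
      · rw [max_eq_right h3]; exact List.mem_cons_of_mem _ h1
      · rw [max_eq_left h3]; exact List.mem_cons_self

theorem length_beforeMax_lt {l : List ℕ} (h : l ≠ []) :
    (beforeMax l).length < l.length := by
  have h1 := List.idxOf_lt_length_of_mem (maxVal_mem h)
  rw [beforeMax, List.length_take]
  omega

theorem length_afterMax_lt {l : List ℕ} (h : l ≠ []) :
    (afterMax l).length < l.length := by
  have h1 := List.length_pos_iff.mpr h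
  rw [afterMax, List.length_drop]
  omega

/-- The stack sorting operator: `S(ε) = ε` and `S(α n β) = S(α) S(β) n`. -/
def S (l : List ℕ) : List ℕ :=
  if h : l = [] then []
  else S (beforeMax l) ++ S (afterMax l) ++ [maxVal l]
termination_by l.length
decreasing_by
  · exact length_beforeMax_lt h
  · exact length_afterMax_lt h

/-- The reversal operator. -/
def R (l : List ℕ) : List ℕ := l.reverse

/-- The decreasing binary tree whose in-order reading is the given word: `Tin(ε)` is the empty
tree and `Tin(α n β)` has root `n`, left subtree `Tin(α)` and right subtree `Tin(β)`. -/
def Tin (l : List ℕ) : BinaryTree ℕ :=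
  if h : l = [] then BinaryTree.nil
  else BinaryTree.node (maxVal l) (Tin (beforeMax l)) (Tin (afterMax l))
termination_by l.length
decreasing_by
  · exact length_beforeMax_lt h
  · exact length_afterMax_lt h

/-- The sum `α ⊕ β = α (β + |α|)`. -/
def oplus (α β : List ℕ) : List ℕ := α ++ β.map (· + α.length)

/-- The skew sum `α ⊖ β = (α + |β|) β`. -/
def ominus (α β : List ℕ) : List ℕ := α.map (· + β.length) ++ β

/-- The map `P` from `231`-avoiding to `132`-avoiding permutations:
`P(ε) = ε` and `P(α ⊕ (1 ⊖ β)) = (P(α) ⊕ 1) ⊖ P(β)` (see `P_oplus` below).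
In `α ⊕ (1 ⊖ β)` the word before the maximum is `α` and the word after it is `β + |α|`.
Values on words that are not `231`-avoiding permutations are irrelevant. -/
def P (l : List ℕ) : List ℕ :=
  if h : l = [] then []
  else ominus (oplus (P (beforeMax l)) [1])
    (P ((afterMax l).map (· - (beforeMax l).length)))
termination_by l.length
decreasing_by
  · exact length_beforeMax_lt h
  · rw [List.length_map]; exact length_afterMax_lt h

/-- The relabeling `λ_π`, sending the value `π(i)` to `P(π)(i)`, so that `P(π) = λ_π ∘ π`.
Numbers that are not values of `π` are fixed. -/
def lam (π : List ℕ) (v : ℕ) : ℕ := (P π).getD (π.idxOf v) v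

/-- The map `Φ_A`, `Φ_A(θ) = λ_{A(θ)} ∘ θ`. -/
def Phi (A : List ℕ → List ℕ) (θ : List ℕ) : List ℕ := θ.map (lam (A θ))

/-- The operators formed by composition from `{S, R}` (the identity being the empty one). -/
inductive IsComposition : (List ℕ → List ℕ) → Prop
  | ident : IsComposition id
  | stack : IsComposition S
  | rev : IsComposition R
  | comp {A B : List ℕ → List ℕ} :
      IsComposition A → IsComposition B → IsComposition (A ∘ B)

/-- The set `A⁻¹(π)` of all permutations `θ` with `A(θ) = π`. -/
def preimages (A : List ℕ → List ℕ) (π : List ℕ) : Set (List ℕ) :=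
  {θ | IsPermutation θ ∧ A θ = π}

/-- The operator `A` respects `P`. -/
def RespectsP (A : List ℕ → List ℕ) : Prop :=
  ∀ π : List ℕ, IsPermutation π → Avoids231 π → (preimages A π).Nonempty →
    (∀ θ ∈ preimages A π,
      A (Phi A θ) = P π ∧ P π = π.map (lam π) ∧
      Phi A θ = θ.map (lam π) ∧
      Tin (Phi A θ) = (Tin θ).map (lam π)) ∧
    Set.BijOn (Phi A) (preimages A π) (preimages A (P π))

/-! The recursive equations in the form `α n β`. -/

theorem maxVal_eq {α β : List ℕ} {n : ℕ} (hα : ∀ x ∈ α, x < n) (hβ : ∀ x ∈ β, x < n) :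
    maxVal (α ++ n :: β) = n := by
  have hb : ∀ l : List ℕ, (∀ x ∈ l, x < n) → maxVal l ≤ n := by
    intro l hl
    by_cases h : l = []
    · subst h; exact Nat.zero_le _
    · exact (hl _ (maxVal_mem h)).le
  induction α with
  | nil => exact max_eq_left (hb β hβ)
  | cons x xs ih =>
    have h1 := ih (fun y hy => hα y (List.mem_cons_of_mem _ hy))
    have h2 : maxVal (x :: xs ++ n :: β) = max x (maxVal (xs ++ n :: β)) := rfl
    rw [h2, h1]
    exact max_eq_right (hα x List.mem_cons_self).le

theorem idxOf_max {α β : List ℕ} {n : ℕ} (hα : ∀ x ∈ α, x < n) :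
    (α ++ n :: β).idxOf n = α.length := by
  rw [List.idxOf_append_of_notMem (fun h => lt_irrefl _ (hα n h))]
  simp

theorem beforeMax_eq {α β : List ℕ} {n : ℕ} (hα : ∀ x ∈ α, x < n) (hβ : ∀ x ∈ β, x < n) :
    beforeMax (α ++ n :: β) = α := by
  rw [beforeMax, maxVal_eq hα hβ, idxOf_max hα]
  simp

theorem afterMax_eq {α β : List ℕ} {n : ℕ} (hα : ∀ x ∈ α, x < n) (hβ : ∀ x ∈ β, x < n) :
    afterMax (α ++ n :: β) = β := by
  rw [afterMax, maxVal_eq hα hβ, idxOf_max hα]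
  simp

theorem S_eq {α β : List ℕ} {n : ℕ} (hα : ∀ x ∈ α, x < n) (hβ : ∀ x ∈ β, x < n) :
    S (α ++ n :: β) = S α ++ S β ++ [n] := by
  rw [S, dif_neg (by simp), beforeMax_eq hα hβ, afterMax_eq hα hβ, maxVal_eq hα hβ]

theorem Tin_eq {α β : List ℕ} {n : ℕ} (hα : ∀ x ∈ α, x < n) (hβ : ∀ x ∈ β, x < n) :
    Tin (α ++ n :: β) = BinaryTree.node n (Tin α) (Tin β) := by
  rw [Tin, dif_neg (by simp), beforeMax_eq hα hβ, afterMax_eq hα hβ, maxVal_eq hα hβ]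

theorem IsPermutation.le_length {π : List ℕ} (h : IsPermutation π) {x : ℕ} (hx : x ∈ π) :
    x ≤ π.length := by
  have h1 := h.mem_iff.mp hx
  rw [List.mem_range'_1] at h1
  omega

theorem P_oplus {α β : List ℕ} (hα : IsPermutation α) (hβ : IsPermutation β) :
    P (oplus α (ominus [1] β)) = ominus (oplus (P α) [1]) (P β) := by
  have h0 : oplus α (ominus [1] β)
      = α ++ (1 + β.length + α.length) :: β.map (· + α.length) := by
    simp [oplus, ominus]
  have h1 : ∀ x ∈ α, x < 1 + β.length + α.length := by
    intro x hx
    have := hα.le_length hx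
    omega
  have h2 : ∀ x ∈ β.map (· + α.length), x < 1 + β.length + α.length := by
    intro x hx
    obtain ⟨y, hy, rfl⟩ := List.mem_map.mp hx
    have := hβ.le_length hy
    show y + α.length < _
    omega
  have h3 : (β.map (· + α.length)).map (· - α.length) = β := by
    rw [List.map_map]
    conv_rhs => rw [← List.map_id β]
    exact List.map_congr_left (fun x _ => Nat.add_sub_cancel x α.length)
  rw [h0, P, dif_neg (by simp), beforeMax_eq h1 h2, afterMax_eq h1 h2, h3]

end StackSort

/-
Applying `f` to the labels of `Tin(l)` gives `Tin(f ∘ l)` as soon as `f` increases along every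
ancestor relation of `Tin(l)`. Reversal mirrors the tree and so keeps these relations, while sorting
can only create new ones, since `S(l)` is the postorder reading of `Tin(l)`. Hence a relabeling that
increases along `Tin(A(θ))` also increases along `Tin(θ)`, and therefore commutes with `A` on `θ`.
For `π ∈ Av(231)` the trees of `π` and `P(π)` have the same shape, so `λ_π` increases along
`Tin(π)`, and the inverse relabeling increases along `Tin(P(π))`.
-/

namespace StackSort

variable {l α β π θ : List ℕ} {f g : ℕ → ℕ} {n : ℕ}

theorem le_maxVal {x : ℕ} (hx : x ∈ l) : x ≤ maxVal l := by
  induction l with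
  | nil => cases hx
  | cons y ys ih =>
    rcases List.mem_cons.mp hx with rfl | hx
    · exact le_max_left _ _
    · exact (ih hx).trans (le_max_right _ _)

theorem beforeMax_append_maxVal_cons_afterMax (h : l ≠ []) :
    beforeMax l ++ maxVal l :: afterMax l = l := by
  have hlt := List.idxOf_lt_length_of_mem (maxVal_mem h)
  calc beforeMax l ++ maxVal l :: afterMax l
      = l.take (l.idxOf (maxVal l)) ++ l[l.idxOf (maxVal l)] :: afterMax l := by
        rw [List.getElem_idxOf, beforeMax]
    _ = l := by rw [afterMax, List.cons_getElem_drop_succ, List.take_append_drop]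

theorem exists_eq_append_max_cons (hl : l.Nodup) (h : l ≠ []) :
    ∃ α β n, l = α ++ n :: β ∧ (∀ x ∈ α, x < n) ∧ ∀ x ∈ β, x < n := by
  have hsplit := beforeMax_append_maxVal_cons_afterMax h
  have hmax : maxVal l ∉ beforeMax l ++ afterMax l := by
    rw [← hsplit] at hl
    exact (List.nodup_cons.mp (List.nodup_middle.mp hl)).1
  have hlt : ∀ x ∈ l, x ∈ beforeMax l ++ afterMax l → x < maxVal l := fun x hx hx' =>
    (le_maxVal hx).lt_of_ne fun e => hmax (e ▸ hx')
  exact ⟨beforeMax l, afterMax l, maxVal l, hsplit.symm,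
    fun x hx => hlt x (List.mem_of_mem_take hx) (List.mem_append_left _ hx),
    fun x hx => hlt x (List.mem_of_mem_drop hx) (List.mem_append_right _ hx)⟩

@[elab_as_elim]
theorem nodup_induction_max {p : (l : List ℕ) → l.Nodup → Prop} (nil : p [] List.nodup_nil)
    (node : ∀ (α β : List ℕ) (n : ℕ), (∀ x ∈ α, x < n) → (∀ x ∈ β, x < n) →
      ∀ hl : (α ++ n :: β).Nodup, p α hl.of_append_left → p β hl.of_append_right.of_cons →
        p (α ++ n :: β) hl)
    (l : List ℕ) (hl : l.Nodup) : p l hl := by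
  induction hk : l.length using Nat.strong_induction_on generalizing l with
  | _ k ih =>
    rcases eq_or_ne l [] with rfl | h
    · exact nil
    · obtain ⟨α, β, n, rfl, hα, hβ⟩ := exists_eq_append_max_cons hl h
      simp only [List.length_append, List.length_cons] at hk
      exact node α β n hα hβ hl (ih _ (by omega) α _ rfl) (ih _ (by omega) β _ rfl)

theorem S_nil : S [] = [] := by rw [S, dif_pos rfl]

theorem Tin_nil : Tin [] = .nil := by rw [Tin, dif_pos rfl]

theorem P_nil : P [] = [] := by rw [P, dif_pos rfl]

theorem S_perm (l : List ℕ) : (S l).Perm l := by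
  induction l using S.induct with
  | case1 => rw [S_nil]
  | case2 l h ihα ihβ =>
    rw [S, dif_neg h, List.append_assoc]
    calc S (beforeMax l) ++ (S (afterMax l) ++ [maxVal l])
        |>.Perm (beforeMax l ++ maxVal l :: afterMax l) :=
          ihα.append ((List.perm_append_singleton _ _).trans (ihβ.cons _))
      _ = l := beforeMax_append_maxVal_cons_afterMax h

theorem map_map_eq_self {ι κ : Type*} {u : List ι} {φ : ι → κ} {ψ : κ → ι}
    (h : ∀ x ∈ u, ψ (φ x) = x) : (u.map φ).map ψ = u := by
  rw [List.map_map]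
  exact (List.map_congr_left h).trans (List.map_id' u)

theorem infix_or_infix_of_notMem {ι : Type*} {u v w : List ι} {a : ι} (hw : w <:+: u ++ a :: v)
    (ha : a ∉ w) : w <:+: u ∨ w <:+: v := by
  have eq_nil_of_prefix : ∀ t, t <+: a :: v → a ∉ t → t = [] := by
    rintro t ht hat
    rcases List.prefix_cons_iff.mp ht with rfl | ⟨t, rfl, -⟩
    · rfl
    · simp at hat
  rcases List.infix_append_iff.mp hw with h | h | ⟨s, t, rfl, hs, ht⟩
  · exact .inl h
  · rcases List.infix_cons_iff.mp h with h | h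
    · exact .inl (eq_nil_of_prefix w h ha ▸ List.nil_infix)
    · exact .inr h
  · obtain rfl := eq_nil_of_prefix t ht fun h => ha (List.mem_append_right s h)
    exact .inl (by simpa using hs.isInfix)

/-- `f` is strictly increasing along every ancestor relation of the decreasing binary tree of `l`:
when the values of `l` are distinct, `x` is a descendant of `n` in `Tin l` if and only if some
factor (contiguous subword) of `l` contains `x` and has maximum `n`. These are the relabelings that
commute with `Tin`. -/
def TreeStrictMono (f : ℕ → ℕ) (l : List ℕ) : Prop :=
  ∀ w, w <:+: l → ∀ n ∈ w, (∀ x ∈ w, x ≤ n) → ∀ x ∈ w, x < n → f x < f n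

theorem treeStrictMono_nil : TreeStrictMono f [] := by
  intro w hw n hn
  rw [List.infix_nil.mp hw] at hn
  cases hn

theorem treeStrictMono_append_cons_iff (hα : ∀ x ∈ α, x < n) (hβ : ∀ x ∈ β, x < n) :
    TreeStrictMono f (α ++ n :: β) ↔
      (∀ x ∈ α, f x < f n) ∧ (∀ x ∈ β, f x < f n) ∧ TreeStrictMono f α ∧ TreeStrictMono f β := by
  have hle : ∀ x ∈ α ++ n :: β, x ≤ n := by
    simpa [or_imp, forall_and] using ⟨fun x hx => (hα x hx).le, fun x hx => (hβ x hx).le⟩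
  constructor
  · intro h
    have hroot := h _ List.infix_rfl n (by simp) hle
    exact ⟨fun x hx => hroot x (by simp [hx]) (hα x hx),
      fun x hx => hroot x (by simp [hx]) (hβ x hx),
      fun w hw => h w (List.infix_append_of_infix_left hw),
      fun w hw => h w (List.infix_append_of_infix_right (List.infix_cons hw))⟩
  · rintro ⟨hfα, hfβ, hmα, hmβ⟩ w hw m hm hmax x hx hlt
    by_cases hn : n ∈ w
    · obtain rfl : m = n := (hle m (hw.subset hm)).antisymm (hmax n hn)
      rcases List.mem_append.mp (hw.subset hx) with hx | hx
      · exact hfα x hx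
      · exact hfβ x ((List.mem_cons.mp hx).resolve_left hlt.ne)
    · rcases infix_or_infix_of_notMem hw hn with hw | hw
      · exact hmα w hw m hm hmax x hx hlt
      · exact hmβ w hw m hm hmax x hx hlt

namespace TreeStrictMono

theorem of_strictMono (hf : StrictMono f) (l : List ℕ) : TreeStrictMono f l :=
  fun _ _ _ _ _ _ _ hlt => hf hlt

theorem of_isInfix {u : List ℕ} (h : TreeStrictMono f l) (hu : u <:+: l) : TreeStrictMono f u :=
  fun w hw => h w (hw.trans hu)

theorem of_reverse (h : TreeStrictMono f l.reverse) : TreeStrictMono f l := by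
  intro w hw n hn hmax x hx hlt
  exact h w.reverse hw.reverse n (List.mem_reverse.mpr hn)
    (fun y hy => hmax y (List.mem_reverse.mp hy)) x (List.mem_reverse.mpr hx) hlt

theorem of_S (hl : l.Nodup) (h : TreeStrictMono f (S l)) : TreeStrictMono f l := by
  induction l, hl using nodup_induction_max with
  | nil => exact treeStrictMono_nil
  | node α β n hα hβ _ ihα ihβ =>
    have hperm : (S α ++ S β).Perm (α ++ β) := (S_perm α).append (S_perm β)
    have hlt : ∀ x ∈ S α ++ S β, x < n := fun x hx =>
      (List.mem_append.mp (hperm.mem_iff.mp hx)).elim (hα x) (hβ x)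
    rw [S_eq hα hβ, treeStrictMono_append_cons_iff hlt (by simp)] at h
    obtain ⟨hf, -, hchildren, -⟩ := h
    exact (treeStrictMono_append_cons_iff hα hβ).mpr
      ⟨fun x hx => hf x (hperm.mem_iff.mpr (List.mem_append_left β hx)),
        fun x hx => hf x (hperm.mem_iff.mpr (List.mem_append_right α hx)),
        ihα (hchildren.of_isInfix List.infix_append_left),
        ihβ (hchildren.of_isInfix List.infix_append_right)⟩

theorem Tin_map (hl : l.Nodup) (h : TreeStrictMono f l) : Tin (l.map f) = (Tin l).map f := by
  induction l, hl using nodup_induction_max with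
  | nil => rw [List.map_nil, Tin_nil, BinaryTree.map]
  | node α β n hα hβ _ ihα ihβ =>
    obtain ⟨hfα, hfβ, hmα, hmβ⟩ := (treeStrictMono_append_cons_iff hα hβ).mp h
    rw [List.map_append, List.map_cons, Tin_eq hα hβ,
      Tin_eq (List.forall_mem_map.mpr hfα) (List.forall_mem_map.mpr hfβ), ihα hmα, ihβ hmβ,
      BinaryTree.map]

theorem S_map (hl : l.Nodup) (h : TreeStrictMono f l) : S (l.map f) = (S l).map f := by
  induction l, hl using nodup_induction_max with
  | nil => rw [List.map_nil, S_nil, List.map_nil]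
  | node α β n hα hβ _ ihα ihβ =>
    obtain ⟨hfα, hfβ, hmα, hmβ⟩ := (treeStrictMono_append_cons_iff hα hβ).mp h
    rw [List.map_append, List.map_cons, S_eq hα hβ,
      S_eq (List.forall_mem_map.mpr hfα) (List.forall_mem_map.mpr hfβ), ihα hmα, ihβ hmβ,
      List.map_append, List.map_append, List.map_singleton]

theorem map_of_leftInverse (h : TreeStrictMono f l) (hg : ∀ x ∈ l, g (f x) = x) :
    TreeStrictMono g (l.map f) := by
  intro w hw n hn hmax x hx hlt
  obtain ⟨w, hwl, rfl⟩ := List.infix_map_iff.mp hw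
  obtain ⟨m, hm, rfl⟩ := List.mem_map.mp hn
  obtain ⟨y, hy, rfl⟩ := List.mem_map.mp hx
  have hmem : maxVal w ∈ w := maxVal_mem (List.ne_nil_of_mem hm)
  have hm_eq : m = maxVal w := (le_maxVal hm).eq_of_not_lt fun hlt' =>
    (hmax _ (List.mem_map_of_mem hmem)).not_gt
      (h w hwl _ hmem (fun _ => le_maxVal) m hm hlt')
  rw [hg m (hwl.subset hm), hg y (hwl.subset hy)]
  exact (hm_eq ▸ le_maxVal hy).lt_of_ne (by rintro rfl; exact hlt.false)

end TreeStrictMono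

namespace IsPermutation

theorem nodup (h : IsPermutation π) : π.Nodup :=
  h.nodup_iff.mpr List.nodup_range'

theorem of_perm (h : IsPermutation π) (hθ : θ.Perm π) : IsPermutation θ := by
  rw [IsPermutation, hθ.length_eq]
  exact hθ.trans h

theorem singleton_one : IsPermutation [1] :=
  .refl _

theorem oplus (hα : IsPermutation α) (hβ : IsPermutation β) : IsPermutation (oplus α β) := by
  have hshift : (List.range' 1 β.length).map (· + α.length) =
      List.range' (1 + α.length) β.length := by
    simp only [add_comm _ α.length, List.map_add_range']
  rw [IsPermutation, StackSort.oplus, List.length_append, List.length_map,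
    ← List.range'_append_1, ← hshift]
  exact List.Perm.append hα (List.Perm.map _ hβ)

theorem ominus (hα : IsPermutation α) (hβ : IsPermutation β) : IsPermutation (ominus α β) :=
  (hβ.oplus hα).of_perm List.perm_append_comm

end IsPermutation

namespace IsComposition

variable {A : List ℕ → List ℕ}

theorem perm (hA : IsComposition A) (l : List ℕ) : (A l).Perm l := by
  induction hA generalizing l with
  | ident => exact .refl l
  | stack => exact S_perm l
  | rev => exact List.reverse_perm l
  | comp _ _ ihA ihB => exact (ihA _).trans (ihB l)

theorem treeStrictMono_of_apply (hA : IsComposition A) (hl : l.Nodup)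
    (h : TreeStrictMono f (A l)) : TreeStrictMono f l := by
  induction hA generalizing l with
  | ident => exact h
  | stack => exact h.of_S hl
  | rev => exact h.of_reverse
  | comp _ hB ihA ihB => exact ihB hl (ihA ((hB.perm l).nodup_iff.mpr hl) h)

theorem apply_map (hA : IsComposition A) (hl : l.Nodup) (h : TreeStrictMono f (A l)) :
    A (l.map f) = (A l).map f := by
  induction hA generalizing l with
  | ident => rfl
  | stack => exact (h.of_S hl).S_map hl
  | rev => exact List.map_reverse.symm
  | @comp A B hA hB ihA ihB =>
    have hBl : (B l).Nodup := (hB.perm l).nodup_iff.mpr hl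
    calc A (B (l.map f))
        = A ((B l).map f) := by rw [ihB hl (hA.treeStrictMono_of_apply hBl h)]
      _ = (A (B l)).map f := ihA hBl h

theorem mapsTo_map_preimages (hA : IsComposition A) (hπ : IsPermutation (π.map f))
    (h : TreeStrictMono f π) :
    Set.MapsTo (List.map f) (preimages A π) (preimages A (π.map f)) := by
  rintro θ ⟨hθ, rfl⟩
  exact ⟨hπ.of_perm ((hA.perm θ).symm.map f), hA.apply_map hθ.nodup h⟩

theorem bijOn_map_preimages (hA : IsComposition A) (hπ : IsPermutation π)
    (hfπ : IsPermutation (π.map f)) (h : TreeStrictMono f π) :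
    Set.BijOn (List.map f) (preimages A π) (preimages A (π.map f)) := by
  have hinj : Set.InjOn f {x | x ∈ π} := fun x hx y hy =>
    List.inj_on_of_nodup_map hfπ.nodup hx hy
  obtain ⟨g, hg⟩ : ∃ g : ℕ → ℕ, ∀ x ∈ π, g (f x) = x :=
    ⟨_, fun _ hx => hinj.leftInvOn_invFunOn hx⟩
  have hgπ : (π.map f).map g = π := map_map_eq_self hg
  have hleft : Set.LeftInvOn (List.map g) (List.map f) (preimages A π) := by
    rintro θ ⟨-, rfl⟩
    exact map_map_eq_self fun x hx => hg x ((hA.perm θ).mem_iff.mpr hx)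
  have hright : Set.RightInvOn (List.map g) (List.map f) (preimages A (π.map f)) := by
    rintro θ ⟨-, hθ⟩
    refine map_map_eq_self fun y hy => ?_
    obtain ⟨x, hx, rfl⟩ := List.mem_map.mp (hθ ▸ (hA.perm θ).mem_iff.mpr hy)
    exact congrArg f (hg x hx)
  have hmapsTo := hA.mapsTo_map_preimages (f := g) (π := π.map f) (hgπ.symm ▸ hπ)
    (h.map_of_leftInverse hg)
  rw [hgπ] at hmapsTo
  exact Set.InvOn.bijOn ⟨hleft, hright⟩ (hA.mapsTo_map_preimages hfπ h) hmapsTo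

end IsComposition

/-- The underlying shape of the decreasing binary tree of `l`, that is, `Tin l` with its labels
forgotten. It is the datum preserved by `P`. -/
def treeShape (l : List ℕ) : BinaryTree Unit :=
  (Tin l).map fun _ => ()

theorem treeShape_append_cons (hα : ∀ x ∈ α, x < n) (hβ : ∀ x ∈ β, x < n) :
    treeShape (α ++ n :: β) = .node () (treeShape α) (treeShape β) := by
  rw [treeShape, Tin_eq hα hβ, BinaryTree.map, treeShape, treeShape]

theorem treeShape_map (hl : l.Nodup) (h : TreeStrictMono f l) :
    treeShape (l.map f) = treeShape l := by
  rw [treeShape, h.Tin_map hl, ← BinaryTree.comp_map]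
  rfl

theorem numNodes_treeShape (hl : l.Nodup) : (treeShape l).numNodes = l.length := by
  induction l, hl using nodup_induction_max with
  | nil => rw [treeShape, Tin_nil, BinaryTree.map, BinaryTree.numNodes, List.length_nil]
  | node α β n hα hβ hl ihα ihβ =>
    rw [treeShape_append_cons hα hβ, BinaryTree.numNodes, ihα, ihβ, List.length_append,
      List.length_cons, add_assoc]

theorem TreeStrictMono.of_treeShape_map_eq (hl : l.Nodup) (hfl : (l.map f).Nodup)
    (h : treeShape (l.map f) = treeShape l) : TreeStrictMono f l := by
  induction l, hl using nodup_induction_max with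
  | nil => exact treeStrictMono_nil
  | node α β n hα hβ hl ihα ihβ =>
    obtain ⟨α', β', n', hsplit, hα', hβ'⟩ := exists_eq_append_max_cons hfl (by simp)
    rw [hsplit] at hfl
    rw [hsplit, treeShape_append_cons hα hβ, treeShape_append_cons hα' hβ'] at h
    obtain ⟨-, hshapeα, hshapeβ⟩ := BinaryTree.node.inj h
    have hlen : (α.map f).length = α'.length := by
      rw [List.length_map, ← numNodes_treeShape hl.of_append_left,
        ← numNodes_treeShape hfl.of_append_left, hshapeα]
    rw [List.map_append, List.map_cons] at hsplit
    obtain ⟨rfl, htail⟩ := List.append_inj hsplit hlen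
    obtain ⟨rfl, rfl⟩ := List.cons.inj htail
    exact (treeStrictMono_append_cons_iff hα hβ).mpr
      ⟨List.forall_mem_map.mp hα', List.forall_mem_map.mp hβ',
        ihα hfl.of_append_left hshapeα, ihβ hfl.of_append_right.of_cons hshapeβ⟩

theorem oplus_ominus_singleton_one (α β : List ℕ) :
    oplus α (ominus [1] β) = α ++ (1 + β.length + α.length) :: β.map (· + α.length) := by
  simp only [oplus, ominus, List.map_cons, List.map_nil, List.singleton_append]

theorem ominus_oplus_singleton_one (α β : List ℕ) :
    ominus (oplus α [1]) β = α.map (· + β.length) ++ (1 + α.length + β.length) :: β := by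
  simp only [oplus, ominus, List.map_append, List.map_cons, List.map_nil, List.append_assoc,
    List.singleton_append]

theorem treeShape_oplus_ominus (hα : IsPermutation α) (hβ : IsPermutation β) :
    treeShape (oplus α (ominus [1] β)) = .node () (treeShape α) (treeShape β) := by
  rw [oplus_ominus_singleton_one, treeShape_append_cons,
    treeShape_map hβ.nodup (.of_strictMono add_left_strictMono β)]
  · intro x hx
    have := hα.le_length hx
    omega
  · rw [List.forall_mem_map]
    intro x hx
    have := hβ.le_length hx
    omega

theorem treeShape_ominus_oplus (hα : IsPermutation α) (hβ : IsPermutation β) :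
    treeShape (ominus (oplus α [1]) β) = .node () (treeShape α) (treeShape β) := by
  rw [ominus_oplus_singleton_one, treeShape_append_cons,
    treeShape_map hα.nodup (.of_strictMono add_left_strictMono α)]
  · rw [List.forall_mem_map]
    intro x hx
    have := hα.le_length hx
    omega
  · intro x hx
    have := hβ.le_length hx
    omega

theorem Avoids231.of_sublist (h : Avoids231 l) (hθ : θ.Sublist l) : Avoids231 θ :=
  fun a b c hab hbc hsub => h a b c hab hbc (hsub.trans hθ)

theorem Avoids231.of_map (hf : StrictMono f) (h : Avoids231 (l.map f)) : Avoids231 l :=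
  fun _ _ _ hab hbc hsub => h _ _ _ (hf hab) (hf hbc) (hsub.map f)

theorem Avoids231.lt_of_mem (h : Avoids231 (α ++ n :: β)) (hα : ∀ x ∈ α, x < n)
    (hd : (α ++ n :: β).Nodup) {x y : ℕ} (hx : x ∈ α) (hy : y ∈ β) : x < y := by
  have hne : x ≠ y := by
    rintro rfl
    exact List.disjoint_of_nodup_append hd hx (List.mem_cons_of_mem n hy)
  have hsub : [x, n, y].Sublist (α ++ n :: β) :=
    (List.singleton_sublist.mpr hx).append ((List.singleton_sublist.mpr hy).cons_cons n)
  exact hne.lt_of_le (not_lt.mp fun hyx => h y x n hyx (hα x hx) hsub)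

theorem perm_range'_of_append_perm {u v : List ℕ} {s : ℕ}
    (h : (u ++ v).Perm (List.range' s (u ++ v).length)) (hlt : ∀ x ∈ u, ∀ y ∈ v, x < y) :
    u.Perm (List.range' s u.length) ∧ v.Perm (List.range' (s + u.length) v.length) := by
  let sort : List ℕ → List ℕ := (List.mergeSort · (· ≤ ·))
  have hperm : ∀ w, (sort w).Perm w := fun w => w.mergeSort_perm _
  have hpairwise : ∀ w, (sort w).Pairwise (· ≤ ·) := List.pairwise_mergeSort' (· ≤ ·)
  have hsorted : (sort u ++ sort v).Pairwise (· ≤ ·) :=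
    List.pairwise_append.mpr ⟨hpairwise u, hpairwise v, fun x hx y hy =>
      (hlt x ((hperm u).mem_iff.mp hx) y ((hperm v).mem_iff.mp hy)).le⟩
  have heq : sort u ++ sort v =
      List.range' s u.length ++ List.range' (s + u.length) v.length := by
    rw [List.range'_append_1, ← List.length_append]
    exact (((hperm u).append (hperm v)).trans h).eq_of_pairwise
      (fun _ _ _ _ => le_antisymm) hsorted (List.pairwise_le_range' _)
  obtain ⟨hu, hv⟩ := List.append_inj heq (by rw [(hperm u).length_eq, List.length_range'])
  exact ⟨hu ▸ (hperm u).symm, hv ▸ (hperm v).symm⟩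

theorem exists_isPermutation_map_add_eq {k : ℕ}
    (h : l.Perm (List.range' (1 + k) l.length)) : ∃ β, IsPermutation β ∧ β.map (· + k) = l := by
  refine ⟨l.map (· - k), ?_, ?_⟩
  · have hsub := h.map (· - k)
    rwa [List.map_sub_range' (by omega), Nat.add_sub_cancel, ← List.length_map (· - k)] at hsub
  · refine map_map_eq_self fun x hx => ?_
    have := List.mem_range'_1.mp (h.mem_iff.mp hx)
    exact Nat.sub_add_cancel (by omega)

theorem exists_eq_oplus_ominus (h : IsPermutation π) (hav : Avoids231 π) (hπ : π ≠ []) :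
    ∃ α β, π = oplus α (ominus [1] β) ∧ IsPermutation α ∧ IsPermutation β ∧
      Avoids231 α ∧ Avoids231 β := by
  obtain ⟨α, γ, n, rfl, hα, hγ⟩ := exists_eq_append_max_cons h.nodup hπ
  have hperm : IsPermutation (α ++ γ ++ [n]) :=
    h.of_perm (by simpa using (List.perm_append_singleton n γ).append_left α)
  obtain ⟨hαγ, hn⟩ := perm_range'_of_append_perm hperm (by
    simpa [or_imp, forall_and] using ⟨hα, hγ⟩)
  obtain ⟨hpα, hpγ⟩ := perm_range'_of_append_perm hαγ fun x hx y hy =>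
    hav.lt_of_mem hα h.nodup hx hy
  obtain ⟨β, hpβ, rfl⟩ := exists_isPermutation_map_add_eq hpγ
  have hsplit : α ++ n :: β.map (· + α.length) = oplus α (ominus [1] β) := by
    have hmax : n = 1 + (α.length + β.length) := by simpa using hn
    rw [oplus_ominus_singleton_one, hmax, add_comm α.length, add_assoc]
  exact ⟨α, β, hsplit, hpα, hpβ, hav.of_sublist (List.sublist_append_left _ _),
    .of_map add_left_strictMono
      (hav.of_sublist ((List.sublist_cons_self n _).trans (List.sublist_append_right _ _)))⟩

@[elab_as_elim]
theorem avoids231_induction {p : List ℕ → Prop} (nil : p [])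
    (node : ∀ α β, IsPermutation α → IsPermutation β → Avoids231 α → Avoids231 β →
      p α → p β → p (oplus α (ominus [1] β)))
    (h : IsPermutation π) (hav : Avoids231 π) : p π := by
  induction hk : π.length using Nat.strong_induction_on generalizing π with
  | _ k ih =>
    rcases eq_or_ne π [] with rfl | hπ
    · exact nil
    · obtain ⟨α, β, rfl, hα, hβ, havα, havβ⟩ := exists_eq_oplus_ominus h hav hπ
      simp only [oplus, ominus, List.length_append, List.length_map, List.length_singleton] at hk
      exact node α β hα hβ havα havβ (ih _ (by omega) hα havα rfl) (ih _ (by omega) hβ havβ rfl)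

theorem isPermutation_P (h : IsPermutation π) (hav : Avoids231 π) : IsPermutation (P π) := by
  refine avoids231_induction ?_ (fun α β hα hβ _ _ hPα hPβ => ?_) h hav
  · rw [P_nil]
    exact .refl _
  · rw [P_oplus hα hβ]
    exact (hPα.oplus .singleton_one).ominus hPβ

theorem treeShape_P (h : IsPermutation π) (hav : Avoids231 π) :
    treeShape (P π) = treeShape π := by
  refine avoids231_induction ?_ (fun α β hα hβ havα havβ ihα ihβ => ?_) h hav
  · rw [P_nil]
  · rw [P_oplus hα hβ, treeShape_oplus_ominus hα hβ, ihα.symm, ihβ.symm,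
      treeShape_ominus_oplus (isPermutation_P hα havα) (isPermutation_P hβ havβ)]

theorem P_eq_map_lam (h : IsPermutation π) (hav : Avoids231 π) : P π = π.map (lam π) := by
  have hlen : (P π).length = π.length := by
    rw [← numNodes_treeShape (isPermutation_P h hav).nodup, treeShape_P h hav,
      numNodes_treeShape h.nodup]
  refine List.ext_getElem (by rw [hlen, List.length_map]) fun i hi hi' => ?_
  rw [List.getElem_map, lam, h.nodup.idxOf_getElem, List.getD_eq_getElem _ _ hi]

theorem isPermutation_map_lam (h : IsPermutation π) (hav : Avoids231 π) :
    IsPermutation (π.map (lam π)) :=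
  P_eq_map_lam h hav ▸ isPermutation_P h hav

theorem treeStrictMono_lam (h : IsPermutation π) (hav : Avoids231 π) :
    TreeStrictMono (lam π) π :=
  .of_treeShape_map_eq h.nodup (isPermutation_map_lam h hav).nodup
    (P_eq_map_lam h hav ▸ treeShape_P h hav)

end StackSort

open StackSort

theorem mainTheorem2 (A : List ℕ → List ℕ) (hA : StackSort.IsComposition A) :
    StackSort.RespectsP A := by
  intro π hπ hav _
  have hP : P π = π.map (lam π) := P_eq_map_lam hπ hav
  have hmono : TreeStrictMono (lam π) π := treeStrictMono_lam hπ hav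
  refine ⟨?_, ?_⟩
  · rintro θ ⟨hθ, rfl⟩
    exact ⟨(hA.apply_map hθ.nodup hmono).trans hP.symm, hP, rfl,
      (hA.treeStrictMono_of_apply hθ.nodup hmono).Tin_map hθ.nodup⟩
  · have hPhi : Set.EqOn (List.map (lam π)) (Phi A) (preimages A π) := by
      rintro θ ⟨-, rfl⟩
      rfl
    rw [hP]
    exact (hA.bijOn_map_preimages hπ (isPermutation_map_lam hπ hav) hmono).congr hPhi
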